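/- Let $G$ be a group and $\alpha$ an ordinal. Call $G$ *$\alpha$-residually finite* if there are subgroups $(G_\beta)_{\beta\le\alpha}$ of $G$ such that $G_0=G$ and $G_\alpha=\{1\}$; $G_\gamma\le G_\beta$ whenever $\beta<\gamma\le\alpha$; the index $[G_\beta:G_{\beta+1}]$ is finite for all $\beta<\alpha$; and $G_\lambda=\bigcap_{\beta<\lambda}G_\beta$ for every limit ordinal $\lambda\le\alpha$. The *residual finiteness depth* of $G$ is the least ordinal $\alpha$ such that $G$ is $\alpha$-residually finite, if such an ordinal exists. **Theorem.** For every countable (non-zero) limit ordinal $\alpha$ there exists a finitely generated group $\Gamma$ whose residual finiteness depth is $\alpha$. -/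

import Mathlib

/-- A group `G` is `α`-residually finite if there is a family of subgroups `(H β)`, `β ≤ α`,
which is descending, starts at `G`, ends at the trivial subgroup, has finite successive
indices `[H β : H (β + 1)]`, and is continuous at the limit ordinals `≤ α`.
(The values of `H` at ordinals `> α` are irrelevant. Since `H (β + 1) ≤ H β`, the relative index
of `H (β + 1)` in `H β` is the usual index; Mathlib's value `0` stands for an infinite index.
`Order.IsSuccLimit` excludes `0`.) -/
def IsOrdinalResiduallyFinite (G : Type*) [Group G] (α : Ordinal) : Prop :=
  ∃ H : Ordinal → Subgroup G,
    H 0 = ⊤ ∧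
    H α = ⊥ ∧
    (∀ β γ, β < γ → γ ≤ α → H γ ≤ H β) ∧
    (∀ β, β < α → (H (β + 1)).relIndex (H β) ≠ 0) ∧
    (∀ l, Order.IsSuccLimit l → l ≤ α → H l = ⨅ β, ⨅ _ : β < l, H β)

/-- `HasResidualFinitenessDepth G α`: the residual finiteness depth of `G` exists and equals `α`,
i.e. `α` is the least ordinal such that `G` is `α`-residually finite. -/
def HasResidualFinitenessDepth (G : Type*) [Group G] (α : Ordinal) : Prop :=
  IsLeast {β | IsOrdinalResiduallyFinite G β} α

open Ordinal

universe u

/-! Iterate the finite residual transfinitely from the whole group. Over ω steps a chain can descend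
at most to the finite residual of its current term, and in a countable group exactly that far. So
for countable G the depth is ω * β when the iterated residuals are infinite before stage β and
trivial at β. As every limit ordinal is ω * β, it remains to find a finitely generated group of each
countable length β ≠ 0. Induct on β, starting with ℤ. At β + 1, use lamps in the perfect group A₅
over a group Q of length β: `mem_iteratedResidual_of_commute_conj` puts all lamps in stage β, and
one more step kills them. At a limit, put countably many shorter groups in a product H and embed
them in a finitely generated subgroup of (H ≀ ℤ) ≀ ℤ; the two copies of ℤ cost nothing since 1 + β =
β. -/

/-- The finite residual of a subgroup `H`: the intersection of its subgroups of finite index. -/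
def finiteResidual {G : Type*} [Group G] (H : Subgroup G) : Subgroup G :=
  sInf {K | K ≤ H ∧ K.relIndex H ≠ 0}

/-- The transfinite iteration of the finite residual, starting at the whole group. -/
def iteratedResidual (G : Type*) [Group G] (γ : Ordinal) : Subgroup G :=
  ⨅ δ : Set.Iio γ, finiteResidual (iteratedResidual G δ.1)
termination_by γ
decreasing_by exact δ.2

/-! ### Functoriality of iterated finite residuals. -/

section Residual

variable {G : Type*} [Group G]

theorem finiteResidual_le_of_relIndex_ne_zero {H K : Subgroup G} (h : K.relIndex H ≠ 0) :
    finiteResidual H ≤ K :=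
  (sInf_le (show K ⊓ H ∈ {K | K ≤ H ∧ K.relIndex H ≠ 0} from
    ⟨inf_le_right, by rwa [Subgroup.inf_relIndex_right]⟩)).trans
    inf_le_left

theorem finiteResidual_le (H : Subgroup G) : finiteResidual H ≤ H :=
  finiteResidual_le_of_relIndex_ne_zero (by simp)

theorem le_finiteResidual_iff {H L : Subgroup G} :
    L ≤ finiteResidual H ↔ ∀ K ≤ H, K.relIndex H ≠ 0 → L ≤ K := by
  simp only [finiteResidual, le_sInf_iff, Set.mem_ofPred_eq, and_imp]

theorem map_finiteResidual_le {K : Type*} [Group K] (f : G →* K) {H : Subgroup G}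
    {L : Subgroup K} (h : H.map f ≤ L) : (finiteResidual H).map f ≤ finiteResidual L := by
  rw [le_finiteResidual_iff]
  intro M _ hM
  rw [Subgroup.map_le_iff_le_comap]
  refine finiteResidual_le_of_relIndex_ne_zero ?_
  rw [Subgroup.relIndex_comap]
  exact fun h0 => hM (Subgroup.relIndex_eq_zero_of_le_right h h0)

theorem finiteResidual_mono {H L : Subgroup G} (h : H ≤ L) :
    finiteResidual H ≤ finiteResidual L := by
  simpa using map_finiteResidual_le (MonoidHom.id G) (H := H) (L := L) (by simpa using h)

theorem le_iteratedResidual_iff {L : Subgroup G} {γ : Ordinal} :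
    L ≤ iteratedResidual G γ ↔ ∀ δ < γ, L ≤ finiteResidual (iteratedResidual G δ) := by
  rw [iteratedResidual, le_iInf_iff]
  simp

theorem iteratedResidual_le_finiteResidual {γ δ : Ordinal} (h : δ < γ) :
    iteratedResidual G γ ≤ finiteResidual (iteratedResidual G δ) :=
  le_iteratedResidual_iff.1 le_rfl δ h

theorem iteratedResidual_antitone : Antitone (iteratedResidual G) := fun _ _ h =>
  le_iteratedResidual_iff.2 fun _ hδ => iteratedResidual_le_finiteResidual (hδ.trans_le h)

@[simp]
theorem iteratedResidual_zero : iteratedResidual G 0 = ⊤ :=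
  top_le_iff.1 (le_iteratedResidual_iff.2 fun _ h => absurd h not_lt_zero)

theorem iteratedResidual_one : iteratedResidual G 1 = finiteResidual ⊤ := by
  refine le_antisymm ?_ ?_
  · simpa using iteratedResidual_le_finiteResidual (G := G) zero_lt_one
  · refine le_iteratedResidual_iff.2 fun δ hδ => ?_
    rw [Order.lt_one_iff.1 hδ, iteratedResidual_zero]

theorem map_iteratedResidual_le {K : Type*} [Group K] (f : G →* K) (γ : Ordinal) :
    (iteratedResidual G γ).map f ≤ iteratedResidual K γ := by
  induction γ using WellFoundedLT.induction with
  | ind γ ih =>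
    exact le_iteratedResidual_iff.2 fun δ hδ =>
      (Subgroup.map_mono (iteratedResidual_le_finiteResidual hδ)).trans
        (map_finiteResidual_le f (ih δ hδ))

theorem iteratedResidual_eq_bot_of_forall_exists_hom {γ : Ordinal}
    (h : ∀ x : G, x ≠ 1 → ∃ (K : Type u) (_ : Group K) (f : G →* K),
      f x ≠ 1 ∧ iteratedResidual K γ = ⊥) : iteratedResidual G γ = ⊥ := by
  rw [eq_bot_iff]
  intro x hx
  by_contra hne
  obtain ⟨K, _, f, hf, hK⟩ := h x hne
  have := map_iteratedResidual_le f γ (Subgroup.mem_map_of_mem f hx)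
  rw [hK] at this
  exact hf this

theorem iteratedResidual_eq_bot_of_injective {K : Type*} [Group K] {f : G →* K}
    (hf : Function.Injective f) {γ : Ordinal} (h : iteratedResidual K γ = ⊥) :
    iteratedResidual G γ = ⊥ := by
  have := map_iteratedResidual_le f γ
  rwa [h, le_bot_iff, Subgroup.map_eq_bot_iff_of_injective _ hf] at this

theorem infinite_iteratedResidual_of_injective {K : Type*} [Group K] {f : G →* K}
    (hf : Function.Injective f) {γ : Ordinal} (h : Infinite (iteratedResidual G γ)) :
    Infinite (iteratedResidual K γ) :=
  Infinite.of_injective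
    (fun x : iteratedResidual G γ =>
      (⟨f x, map_iteratedResidual_le f γ (Subgroup.mem_map_of_mem f x.2)⟩ :
        iteratedResidual K γ))
    fun _ _ hxy => Subtype.ext (hf (congrArg Subtype.val hxy))

/-- Once the iteration has entered N, restarting it from all of N can only slow it down. -/
theorem iteratedResidual_add_le {N : Subgroup G} {β : Ordinal} (hN : iteratedResidual G β ≤ N)
    (γ : Ordinal) : iteratedResidual G (β + γ) ≤ (iteratedResidual N γ).map N.subtype := by
  induction γ using WellFoundedLT.induction with
  | ind γ ih =>
    intro x hx
    have hxN : x ∈ N := hN (iteratedResidual_antitone (by simp) hx)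
    refine ⟨⟨x, hxN⟩, ?_, rfl⟩
    rw [SetLike.mem_coe, ← Subgroup.zpowers_le, le_iteratedResidual_iff]
    intro δ hδ
    rw [le_finiteResidual_iff]
    intro M hM hMi
    rw [Subgroup.zpowers_le]
    have h1 := finiteResidual_mono (ih δ hδ)
      (iteratedResidual_le_finiteResidual (by simpa using hδ) hx)
    have h2 : (M.map N.subtype).relIndex ((iteratedResidual N δ).map N.subtype) ≠ 0 := by
      rwa [Subgroup.relIndex_map_map_of_injective _ _ N.subtype_injective]
    obtain ⟨y, hy, hyx⟩ := finiteResidual_le_of_relIndex_ne_zero h2 h1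
    have : y = ⟨x, hxN⟩ := Subtype.ext hyx
    exact this ▸ hy

end Residual

/-! ### Depth in terms of iterated residuals. -/

section Depth

variable {G : Type*} [Group G]

theorem relIndex_ne_zero_add_natCast {α : Ordinal} {H : Ordinal → Subgroup G}
    (hfin : ∀ β, β < α → (H (β + 1)).relIndex (H β) ≠ 0) (β : Ordinal) (n : ℕ)
    (h : β + n ≤ α) : (H (β + n)).relIndex (H β) ≠ 0 := by
  induction n with
  | zero => simp
  | succ n ih =>
    have hlt : β + n < α := lt_of_lt_of_le (by simp) h
    have h1 := hfin _ hlt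
    rw [add_assoc, ← Nat.cast_succ] at h1
    exact Subgroup.relIndex_ne_zero_trans h1 (ih hlt.le)

/-- Below ω * γ each term is finitely many steps after some ω * ε, hence of finite index in the term
there, so it contains the finite residual of that term. -/
theorem iteratedResidual_le_of_chain {α : Ordinal} {H : Ordinal → Subgroup G}
    (h0 : H 0 = ⊤)
    (hfin : ∀ β, β < α → (H (β + 1)).relIndex (H β) ≠ 0)
    (hlim : ∀ l, Order.IsSuccLimit l → l ≤ α → H l = ⨅ β, ⨅ _ : β < l, H β)
    (γ : Ordinal) (hγ : ω * γ ≤ α) : iteratedResidual G γ ≤ H (ω * γ) := by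
  induction γ using WellFoundedLT.induction with
  | ind γ ih =>
    rcases eq_or_ne γ 0 with rfl | hne
    · simp [h0]
    have hl : Order.IsSuccLimit (ω * γ) :=
      isSuccLimit_iff.2 ⟨mul_ne_zero omega0_ne_zero hne,
        isSuccPrelimit_iff_omega0_dvd.2 (dvd_mul_right _ _)⟩
    rw [hlim _ hl hγ]
    refine le_iInf₂ fun η hη => ?_
    have hε : η / ω < γ := (lt_mul_iff_div_lt omega0_ne_zero).1 hη
    obtain ⟨n, hn⟩ := lt_omega0.1 (mod_lt η omega0_ne_zero)
    have hηeq : ω * (η / ω) + n = η := by rw [← hn, div_add_mod]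
    have hle : ω * (η / ω) ≤ η := by conv_rhs => rw [← hηeq]
                                     simp
    have h1 := relIndex_ne_zero_add_natCast hfin (ω * (η / ω)) n
      (by rw [hηeq]; exact hη.le.trans hγ)
    rw [hηeq] at h1
    exact (iteratedResidual_le_finiteResidual hε).trans
      ((finiteResidual_mono (ih _ hε (hle.trans (hη.le.trans hγ)))).trans
        (finiteResidual_le_of_relIndex_ne_zero h1))

theorem omega0_mul_le_of_isOrdinalResiduallyFinite {α β : Ordinal}
    (hβ : ∀ γ < β, Infinite (iteratedResidual G γ)) (h : IsOrdinalResiduallyFinite G α) :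
    ω * β ≤ α := by
  obtain ⟨H, h0, hbot, -, hfin, hlim⟩ := h
  by_contra! hlt
  have hε : α / ω < β := (lt_mul_iff_div_lt omega0_ne_zero).1 hlt
  obtain ⟨n, hn⟩ := lt_omega0.1 (mod_lt α omega0_ne_zero)
  have heq : ω * (α / ω) + n = α := by rw [← hn, div_add_mod]
  have hle : ω * (α / ω) ≤ α := by conv_rhs => rw [← heq]
                                   simp
  have h1 := relIndex_ne_zero_add_natCast hfin (ω * (α / ω)) n heq.le
  rw [heq, hbot, Subgroup.relIndex_bot_left] at h1
  have h2 := iteratedResidual_le_of_chain h0 hfin hlim _ hle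
  have := hβ _ hε
  have : Infinite (H (ω * (α / ω))) := Infinite.of_injective _ (Subgroup.inclusion_injective h2)
  exact h1 Nat.card_eq_zero_of_infinite

/-- Countability allows one excluding finite-index subgroup per element outside the residual. -/
theorem exists_seq_inf_iInf_eq_finiteResidual [Countable G] (H : Subgroup G) :
    ∃ M : ℕ → Subgroup G, (∀ n, (M n).relIndex H ≠ 0) ∧ H ⊓ ⨅ n, M n ≤ finiteResidual H := by
  obtain ⟨e, he⟩ := exists_surjective_nat G
  have key : ∀ x : G, ∃ K : Subgroup G, K.relIndex H ≠ 0 ∧ (x ∈ K → x ∈ finiteResidual H) := by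
    intro x
    by_cases hx : x ∈ finiteResidual H
    · exact ⟨H, by simp, fun _ => hx⟩
    · rw [← Subgroup.zpowers_le, le_finiteResidual_iff] at hx
      push Not at hx
      obtain ⟨K, -, hK, hxK⟩ := hx
      rw [Subgroup.zpowers_le] at hxK
      exact ⟨K, hK, fun h => absurd h hxK⟩
  choose M hM hM' using key
  refine ⟨fun n => M (e n), fun n => hM _, ?_⟩
  rintro x ⟨-, hx⟩
  obtain ⟨n, rfl⟩ := he x
  exact hM' _ (iInf_le (fun n => M (e n)) n hx)

/-- Between consecutive residuals, the chain intersects one more subgroup of the sequence M at each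
finite step. -/
theorem isOrdinalResiduallyFinite_omega0_mul [Countable G] {β : Ordinal.{u}}
    (hβ : iteratedResidual G β = ⊥) : IsOrdinalResiduallyFinite G (ω * β) := by
  choose M hM hM' using fun γ => exists_seq_inf_iInf_eq_finiteResidual (iteratedResidual G γ)
  let K (γ o : Ordinal) : Subgroup G :=
    iteratedResidual G γ ⊓ ⨅ i : ℕ, ⨅ _ : (i : Ordinal) < o, M γ i
  have hK0 (γ) : K γ 0 = iteratedResidual G γ := by simp [K]
  have hKle (γ o) : K γ o ≤ iteratedResidual G γ := inf_le_left
  have hleK (γ o) : finiteResidual (iteratedResidual G γ) ≤ K γ o :=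
    le_inf (finiteResidual_le _)
      (le_iInf₂ fun i _ => finiteResidual_le_of_relIndex_ne_zero (hM γ i))
  have hKanti (γ) {o o' : Ordinal} (h : o ≤ o') : K γ o' ≤ K γ o :=
    inf_le_inf_left _ (le_iInf₂ fun i hi => iInf₂_le i (hi.trans_le h))
  have hdiv (γ : Ordinal.{u}) (n : ℕ) : (ω * γ + n) / ω = γ := by
    rw [mul_add_div _ omega0_ne_zero, div_eq_zero_of_lt (natCast_lt_omega0 n), add_zero]
  have hmod (γ : Ordinal.{u}) (n : ℕ) : (ω * γ + n) % ω = n := by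
    rw [mul_add_mod_self, mod_eq_of_lt (natCast_lt_omega0 n)]
  have hdiv0 (γ : Ordinal.{u}) : (ω * γ) / ω = γ := by
    simpa only [Nat.cast_zero, add_zero] using hdiv γ 0
  have hmod0 (γ : Ordinal.{u}) : (ω * γ) % ω = 0 := by
    simpa only [Nat.cast_zero, add_zero] using hmod γ 0
  have hanti : ∀ η ξ : Ordinal, η < ξ → K (ξ / ω) (ξ % ω) ≤ K (η / ω) (η % ω) := by
    intro η ξ h
    rcases lt_or_ge (η / ω) (ξ / ω) with hlt | hge
    · exact (hKle _ _).trans ((iteratedResidual_le_finiteResidual hlt).trans (hleK _ _))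
    · have heq : η / ω = ξ / ω := by
        refine le_antisymm ?_ hge
        rw [← not_lt, ← lt_mul_iff_div_lt omega0_ne_zero, not_lt]
        exact (mul_div_le η ω).trans h.le
      rw [heq]
      refine hKanti _ ?_
      have h1 : ω * (ξ / ω) + η % ω ≤ ω * (ξ / ω) + ξ % ω := by
        rw [div_add_mod, ← heq, div_add_mod]
        exact h.le
      simpa using h1
  refine ⟨fun η => K (η / ω) (η % ω), ?_, ?_, fun η ξ h _ => hanti η ξ h, ?_, ?_⟩
  · simpa using hK0 0
  · simp only [hdiv0, hmod0, hK0, hβ]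
  · intro η _
    obtain ⟨n, hn⟩ := lt_omega0.1 (mod_lt η omega0_ne_zero)
    have hηeq : η = ω * (η / ω) + n := by rw [← hn, div_add_mod]
    generalize η / ω = γ at hηeq
    subst hηeq
    have hs : ω * γ + n + 1 = ω * γ + ((n + 1 : ℕ) : Ordinal) := by
      rw [add_assoc, Nat.cast_succ]
    simp only [hs, hdiv, hmod]
    have h1 : M γ n ⊓ K γ n ≤ K γ ((n + 1 : ℕ) : Ordinal) := by
      refine le_inf (inf_le_right.trans (hKle _ _)) (le_iInf₂ fun i hi => ?_)
      rw [Nat.cast_lt] at hi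
      rcases (Nat.lt_succ_iff_lt_or_eq.1 hi) with h | rfl
      · exact inf_le_right.trans (inf_le_right.trans (iInf₂_le i (by exact_mod_cast h)))
      · exact inf_le_left
    intro h0
    have h2 := Subgroup.relIndex_eq_zero_of_le_left h1 h0
    rw [Subgroup.inf_relIndex_right] at h2
    exact hM γ n (Subgroup.relIndex_eq_zero_of_le_right (hKle γ n) h2)
  · intro l hl _
    obtain ⟨γ, rfl⟩ := isSuccPrelimit_iff_omega0_dvd.1 hl.isSuccPrelimit
    refine le_antisymm (le_iInf₂ fun η hη => hanti _ _ hη) ?_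
    simp only [hdiv0, hmod0, hK0]
    refine le_iteratedResidual_iff.2 fun ε hε => le_trans ?_ (hM' ε)
    have hlt (n : ℕ) : ω * ε + n < ω * γ := by
      rw [lt_mul_iff_div_lt omega0_ne_zero, hdiv]
      exact hε
    have hle (n : ℕ) :
        ⨅ η, ⨅ _ : η < ω * γ, K (η / ω) (η % ω) ≤ K ε n := by
      have := iInf₂_le (f := fun η (_ : η < ω * γ) => K (η / ω) (η % ω)) _ (hlt n)
      rwa [hdiv, hmod] at this
    -- Stage n only involves M with index below n, so M ε n enters at stage n + 1.
    have hKM (n : ℕ) : K ε ((n + 1 : ℕ) : Ordinal) ≤ M ε n :=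
      inf_le_right.trans (iInf₂_le (f := fun (i : ℕ)
        (_ : (i : Ordinal) < ((n + 1 : ℕ) : Ordinal)) => M ε i) n (Nat.cast_lt.2 n.lt_succ_self))
    exact le_inf ((hle 0).trans (hKle _ _)) (le_iInf fun n => (hle (n + 1)).trans (hKM n))

theorem hasResidualFinitenessDepth_omega0_mul [Countable G] {β : Ordinal}
    (hβ : iteratedResidual G β = ⊥) (hinf : ∀ γ < β, Infinite (iteratedResidual G γ)) :
    HasResidualFinitenessDepth G (ω * β) :=
  ⟨isOrdinalResiduallyFinite_omega0_mul hβ,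
    fun _ h => omega0_mul_le_of_isOrdinalResiduallyFinite hinf h⟩

end Depth

/-! ### Basic residually finite groups and products. -/

section Examples

theorem iteratedResidual_one_of_finite (G : Type*) [Group G] [Finite G] :
    iteratedResidual G 1 = ⊥ := by
  rw [iteratedResidual_one, eq_bot_iff]
  refine finiteResidual_le_of_relIndex_ne_zero ?_
  rw [Subgroup.relIndex_bot_left]
  exact Nat.card_pos.ne'

theorem iteratedResidual_one_multiplicative_int :
    iteratedResidual (Multiplicative ℤ) 1 = ⊥ := by
  refine iteratedResidual_eq_bot_of_forall_exists_hom fun x hx => ?_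
  let n : ℕ := (Multiplicative.toAdd x).natAbs + 1
  refine ⟨Multiplicative (ZMod n), inferInstance,
    AddMonoidHom.toMultiplicative (Int.castAddHom (ZMod n)), fun h => hx ?_,
    iteratedResidual_one_of_finite _⟩
  have h1 : ((Multiplicative.toAdd x : ℤ) : ZMod n) = 0 := h
  rw [ZMod.intCast_zmod_eq_zero_iff_dvd] at h1
  have h2 := Int.eq_zero_of_abs_lt_dvd h1 (by simp only [n]; push_cast; omega)
  exact h2

theorem iteratedResidual_pi_eq_bot {ι : Type*} {G : ι → Type u} [∀ i, Group (G i)]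
    {γ : Ordinal} (h : ∀ i, iteratedResidual (G i) γ = ⊥) :
    iteratedResidual (∀ i, G i) γ = ⊥ := by
  refine iteratedResidual_eq_bot_of_forall_exists_hom fun x hx => ?_
  obtain ⟨i, hi⟩ := Function.ne_iff.1 hx
  exact ⟨G i, inferInstance, Pi.evalMonoidHom G i, hi, h i⟩

theorem countable_of_group_fg (G : Type*) [Group G] (h : Group.FG G) : Countable G := by
  obtain ⟨α, _, φ, hφ⟩ := Group.fg_iff_exists_freeGroup_hom_surjective_finite.1 h
  exact hφ.countable

end Examples

/-! ### Unrestricted regular wreath products. -/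

namespace RegularWreathProduct

variable {D Q : Type*} [Group D] [Group Q]

/-- The inclusion of the base group into the wreath product. -/
def base : (Q → D) →* D ≀ᵣ Q where
  toFun f := ⟨f, 1⟩
  map_one' := rfl
  map_mul' f g := by ext <;> simp

@[simp]
theorem base_left (f : Q → D) : (base f).left = f := rfl

@[simp]
theorem base_right (f : Q → D) : (base f).right = 1 := rfl

theorem base_injective : Function.Injective (base : (Q → D) →* D ≀ᵣ Q) := fun _ _ h =>
  congrArg left h

theorem inl_mul_base_mul_inl_inv (p : Q) (f : Q → D) :
    inl p * base f * (inl p)⁻¹ = base fun x => f (p⁻¹ * x) := by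
  ext <;> simp

/-- Evaluation of the left component at `q`, on the kernel of the projection. -/
def evalKer (q : Q) : (rightHom : D ≀ᵣ Q →* Q).ker →* D where
  toFun x := x.1.left q
  map_one' := rfl
  map_mul' x y := by
    have hx : x.1.right = 1 := x.2
    simp [hx]

/-- After β steps only the base group is left, and its coordinates map it to D. -/
theorem iteratedResidual_add_eq_bot {D : Type u} [Group D] {β γ : Ordinal}
    (hQ : iteratedResidual Q β = ⊥) (hD : iteratedResidual D γ = ⊥) :
    iteratedResidual (D ≀ᵣ Q) (β + γ) = ⊥ := by
  have hN : iteratedResidual (D ≀ᵣ Q) β ≤ (rightHom : D ≀ᵣ Q →* Q).ker := by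
    have := map_iteratedResidual_le (rightHom : D ≀ᵣ Q →* Q) β
    rw [hQ, le_bot_iff] at this
    exact (Subgroup.map_eq_bot_iff _).1 this
  have hker : iteratedResidual (rightHom : D ≀ᵣ Q →* Q).ker γ = ⊥ := by
    refine iteratedResidual_eq_bot_of_forall_exists_hom fun x hx => ?_
    have hr : x.1.right = 1 := x.2
    have : x.1.left ≠ 1 := fun h => hx (Subtype.ext (RegularWreathProduct.ext h hr))
    obtain ⟨q, hq⟩ := Function.ne_iff.1 this
    exact ⟨D, inferInstance, evalKer q, hq, hD⟩
  have := iteratedResidual_add_le hN γ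
  rwa [hker, Subgroup.map_bot, le_bot_iff] at this

/-- The inclusion of `D` as the factor of the base group with index `q`. -/
def single [DecidableEq Q] (q : Q) : D →* D ≀ᵣ Q :=
  base.comp (MonoidHom.mulSingle (fun _ : Q => D) q)

variable [DecidableEq Q]

theorem single_apply (q : Q) (a : D) : (single q a : D ≀ᵣ Q) = base (Pi.mulSingle q a) := rfl

theorem single_injective (q : Q) : Function.Injective (single q : D →* D ≀ᵣ Q) :=
  base_injective.comp (Pi.mulSingle_injective (M := fun _ : Q => D) q)

theorem inl_mul_single_mul_inl_inv (p q : Q) (a : D) :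
    inl p * single q a * (inl p)⁻¹ = (single (p * q) a : D ≀ᵣ Q) := by
  rw [single_apply, inl_mul_base_mul_inl_inv, single_apply]
  congr 1
  ext x
  simp only [Pi.mulSingle_apply, inv_mul_eq_iff_eq_mul]

theorem commute_single {p q : Q} (h : p ≠ q) (a b : D) :
    Commute (single p a : D ≀ᵣ Q) (single q b) :=
  (Pi.mulSingle_commute (f := fun _ : Q => D) h a b).map base

end RegularWreathProduct

/-! ### Perfect lamps and the successor step. -/

theorem monoidHom_eq_one_of_commute {A B : Type*} [Group A] [Group B]
    (hA : commutator A = ⊤) (f : A →* B) (h : ∀ a b, Commute (f a) (f b)) (a : A) : f a = 1 := by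
  have : commutator A ≤ f.ker := by
    rw [commutator_def, Subgroup.commutator_le]
    intro x _ y _
    rw [MonoidHom.mem_ker, map_commutatorElement, commutatorElement_eq_one_iff_commute]
    exact h x y
  exact this (hA ▸ Subgroup.mem_top a)

/-- A perfect group whose translates under an infinite group `Q` commute lies in the iterated
residuals as long as those of `Q` are infinite. -/
theorem mem_iteratedResidual_of_commute_conj {G Q A : Type*} [Group G] [Group Q] [Group A]
    (hA : commutator A = ⊤) {i : Q →* G} (j : Q → A →* G)
    (hconj : ∀ p q a, i p * j q a * (i p)⁻¹ = j (p * q) a)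
    (hcomm : ∀ p q, p ≠ q → ∀ a b, Commute (j p a) (j q b)) {β : Ordinal}
    (hinf : ∀ γ < β, Infinite (iteratedResidual Q γ)) (q : Q) (a : A) :
    j q a ∈ iteratedResidual G β := by
  induction β using WellFoundedLT.induction generalizing q a with
  | ind β ih =>
    rw [← Subgroup.zpowers_le, le_iteratedResidual_iff]
    intro γ hγ
    rw [le_finiteResidual_iff]
    intro N _ hN
    rw [Subgroup.zpowers_le]
    have ih' := ih γ hγ fun δ hδ => hinf δ (hδ.trans hγ)
    let R := iteratedResidual G γ
    let C : Subgroup R := (N.subgroupOf R).normalCore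
    have hfi : (N.subgroupOf R).FiniteIndex := ⟨hN⟩
    let i' : iteratedResidual Q γ →* R :=
      (i.comp (iteratedResidual Q γ).subtype).codRestrict R fun x =>
        map_iteratedResidual_le i γ (Subgroup.mem_map_of_mem i x.2)
    have : Infinite (iteratedResidual Q γ) := hinf γ hγ
    -- An infinite residual of Q meets the finite-index subgroup C nontrivially; this yields p ≠ 1
    -- acting trivially modulo C.
    have hne : C.comap i' ≠ ⊥ := by
      intro h0
      have h1 := Subgroup.relIndex_comap_ne_zero i' (J := C) (K := ⊤) (by
        rw [Subgroup.relIndex_top_right]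
        exact Subgroup.FiniteIndex.index_ne_zero)
      rw [h0, Subgroup.comap_top, Subgroup.relIndex_top_right, Subgroup.index_bot] at h1
      exact h1 Nat.card_eq_zero_of_infinite
    obtain ⟨⟨p, hpC⟩, hp⟩ := Subgroup.ne_bot_iff_exists_ne_one.1 hne
    have hp1 : p ≠ 1 := fun h => hp (Subtype.ext h)
    let j' (q : Q) : A →* R := (j q).codRestrict R (ih' q)
    have hmk (b : A) : (QuotientGroup.mk' C) (j' q b) = QuotientGroup.mk' C (j' (p.1 * q) b) := by
      have h1 : j' (p.1 * q) b = i' p * j' q b * (i' p)⁻¹ :=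
        Subtype.ext (hconj p.1 q b).symm
      have h2 : QuotientGroup.mk' C (i' p) = 1 := (QuotientGroup.eq_one_iff _).2 hpC
      rw [h1, map_mul, map_mul, map_inv, h2]
      simp
    -- Modulo C the copy of A at q agrees with the one at p * q, which commutes with it; a perfect
    -- group with commuting image dies.
    have key := monoidHom_eq_one_of_commute hA ((QuotientGroup.mk' C).comp (j' q)) (fun x y => by
      simp only [MonoidHom.comp_apply]
      rw [hmk y]
      refine Commute.map ?_ _
      refine Subtype.ext (hcomm q (p.1 * q) (fun h => hp1 (Subtype.ext ?_)) x y)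
      simpa using h.symm) a
    have hmem : j' q a ∈ C := (QuotientGroup.eq_one_iff _).1 key
    exact Subgroup.mem_subgroupOf.1 (Subgroup.normalCore_le _ hmem)

/-- The iterated residuals of `G` become trivial exactly at `β`, and are infinite before. -/
def HasResidualLength (G : Type*) [Group G] (β : Ordinal) : Prop :=
  iteratedResidual G β = ⊥ ∧ ∀ γ < β, Infinite (iteratedResidual G γ)

theorem hasResidualLength_multiplicative_int : HasResidualLength (Multiplicative ℤ) 1 := by
  refine ⟨iteratedResidual_one_multiplicative_int, fun γ hγ => ?_⟩
  rw [Order.lt_one_iff.1 hγ, iteratedResidual_zero]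
  infer_instance

theorem commutator_alternatingGroup_five : commutator (alternatingGroup (Fin 5)) = ⊤ :=
  commutator_alternatingGroup_eq_top (by simp)

theorem exists_fg_hasResidualLength_add_one {Q : Type} [Group Q] (hQ : Group.FG Q) {β : Ordinal}
    (h0 : β ≠ 0) (hβ : HasResidualLength Q β) :
    ∃ (Γ : Type) (_ : Group Γ), Group.FG Γ ∧ HasResidualLength Γ (β + 1) := by
  classical
  let A := alternatingGroup (Fin 5)
  let Γ : Subgroup (A ≀ᵣ Q) :=
    (RegularWreathProduct.single 1).range ⊔ RegularWreathProduct.inl.range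
  have hinl (q : Q) : RegularWreathProduct.inl q ∈ Γ :=
    le_sup_right (a := (RegularWreathProduct.single 1).range) ⟨q, rfl⟩
  have hsingle (q : Q) (a : A) : RegularWreathProduct.single q a ∈ Γ := by
    have h1 : RegularWreathProduct.single 1 a ∈ Γ :=
      le_sup_left (b := RegularWreathProduct.inl.range) ⟨a, rfl⟩
    have := Γ.mul_mem (Γ.mul_mem (hinl q) h1) (Γ.inv_mem (hinl q))
    rwa [RegularWreathProduct.inl_mul_single_mul_inl_inv, mul_one] at this
  let i : Q →* Γ := RegularWreathProduct.inl.codRestrict Γ hinl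
  let j (q : Q) : A →* Γ := (RegularWreathProduct.single q).codRestrict Γ (hsingle q)
  have hmem (q : Q) (a : A) : j q a ∈ iteratedResidual Γ β :=
    mem_iteratedResidual_of_commute_conj commutator_alternatingGroup_five (i := i) j
      (fun p q a => Subtype.ext (RegularWreathProduct.inl_mul_single_mul_inl_inv p q a))
      (fun p q hpq a b => Subtype.ext (RegularWreathProduct.commute_single hpq a b)) hβ.2 q a
  have : Infinite Q := by
    have := hβ.2 0 (pos_iff_ne_zero.2 h0)
    exact Infinite.of_injective _ (iteratedResidual Q 0).subtype_injective
  refine ⟨Γ, inferInstance, ?_, ?_, fun γ hγ => ?_⟩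
  · rw [Group.fg_iff_subgroup_fg]
    refine Subgroup.FG.sup ?_ ?_ <;> rw [← Group.fg_iff_subgroup_fg] <;> infer_instance
  · exact iteratedResidual_eq_bot_of_injective Γ.subtype_injective
      (RegularWreathProduct.iteratedResidual_add_eq_bot hβ.1 (iteratedResidual_one_of_finite A))
  · obtain ⟨a, ha⟩ := exists_ne (1 : A)
    have : Infinite (iteratedResidual Γ β) := by
      refine Infinite.of_injective (fun q : Q => (⟨j q a, hmem q a⟩ : iteratedResidual Γ β)) ?_
      intro p q hpq
      have h1 : (Pi.mulSingle p a : Q → A) = Pi.mulSingle q a :=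
        RegularWreathProduct.base_injective (congrArg (fun x => x.1.1) hpq)
      by_contra hne
      have h2 := congrFun h1 p
      rw [Pi.mulSingle_eq_same, Pi.mulSingle_eq_of_ne hne] at h2
      exact ha h2
    exact Infinite.of_injective _
      (Subgroup.inclusion_injective (iteratedResidual_antitone (Order.lt_add_one_iff.1 hγ)))

/-! ### Embedding countable families in finitely generated groups. -/

section Embedding

open RegularWreathProduct
open scoped commutatorElement

variable {H : Type u} [Group H]

local notation "C" => Multiplicative ℤ

/-- The step function in the base group of `H ≀ᵣ ℤ` with value `x` on the nonnegative integers. -/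
def wreathStep (x : H) : H ≀ᵣ C := base fun n => if 0 ≤ Multiplicative.toAdd n then x else 1

theorem commutator_wreathStep (x : H) :
    ⁅wreathStep x, (inl (Multiplicative.ofAdd 1) : H ≀ᵣ C)⁆ = single 1 x := by
  rw [commutatorElement_def]
  have h1 := inl_mul_base_mul_inl_inv (D := H) (Multiplicative.ofAdd (1 : ℤ))
    (fun n => if 0 ≤ Multiplicative.toAdd n then x⁻¹ else 1)
  have h2 : (wreathStep x)⁻¹ =
      base fun n : C => if 0 ≤ Multiplicative.toAdd n then x⁻¹ else 1 := by
    rw [wreathStep, ← map_inv]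
    congr 1
    ext n
    simp only [Pi.inv_apply]
    split_ifs <;> simp
  rw [mul_assoc, mul_assoc, h2, ← mul_assoc (inl _), h1, wreathStep, ← map_mul, single_apply]
  congr 1
  ext n
  obtain ⟨m, rfl⟩ := Multiplicative.ofAdd.surjective n
  simp only [Pi.mul_apply, Pi.mulSingle_apply, toAdd_mul, toAdd_inv, toAdd_ofAdd, ofAdd_eq_one]
  split_ifs <;> first | omega | simp

/-- The element of the base group of `(H ≀ᵣ ℤ) ≀ᵣ ℤ` which together with the generator of `ℤ`
generates a subgroup containing copies of all `h i`. -/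
def encodingFunction (h : ℕ → H) (n : C) : H ≀ᵣ C :=
  if Multiplicative.toAdd n = 0 then inl (Multiplicative.ofAdd 1)
  else if 0 < Multiplicative.toAdd n ∧ Multiplicative.toAdd n % 2 = 1 then
    wreathStep (h (Multiplicative.toAdd n / 2).toNat)
  else 1

/-- A copy of `H` in the twice iterated wreath product. -/
def singleSingle : H →* (H ≀ᵣ C) ≀ᵣ C := (single 1).comp (single 1)

theorem singleSingle_injective : Function.Injective (singleSingle (H := H)) :=
  (single_injective 1).comp (single_injective 1)

/-- The shift moves position 2i + 1 to 0, where the step for `h i` meets the generator of ℤ.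
Elsewhere one entry is trivial: the other support is in the positive odd numbers, and an odd shift
makes them even. -/
theorem singleSingle_eq_commutator (h : ℕ → H) (i : ℕ) :
    singleSingle (h i) =
      ⁅inl (Multiplicative.ofAdd (-(2 * i + 1) : ℤ)) * base (encodingFunction h) *
        (inl (Multiplicative.ofAdd (-(2 * i + 1) : ℤ)))⁻¹, base (encodingFunction h)⁆ := by
  rw [inl_mul_base_mul_inl_inv, ← map_commutatorElement, singleSingle, MonoidHom.comp_apply,
    single_apply]
  congr 1
  ext1 n
  obtain ⟨m, rfl⟩ := Multiplicative.ofAdd.surjective n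
  have hcomm : ∀ f g : C → H ≀ᵣ C, ∀ x, ⁅f, g⁆ x = ⁅f x, g x⁆ := fun _ _ _ => rfl
  rw [hcomm]
  rcases eq_or_ne m 0 with rfl | hm
  · have h1 : encodingFunction h (Multiplicative.ofAdd (0 : ℤ)) = inl (Multiplicative.ofAdd 1) := by
      simp [encodingFunction]
    have h2 : encodingFunction h ((Multiplicative.ofAdd (-(2 * i + 1) : ℤ))⁻¹ *
        Multiplicative.ofAdd 0) = wreathStep (h i) := by
      simp only [encodingFunction, toAdd_mul, toAdd_inv, toAdd_ofAdd]
      rw [if_neg (by omega), if_pos (by omega)]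
      congr 2
      omega
    rw [h1, h2, commutator_wreathStep]
    exact Pi.mulSingle_eq_same _ _
  · rw [Pi.mulSingle_eq_of_ne (by simpa using hm)]
    by_cases hm' : 0 < m ∧ m % 2 = 1
    · have h2 : encodingFunction h ((Multiplicative.ofAdd (-(2 * i + 1) : ℤ))⁻¹ *
          Multiplicative.ofAdd m) = 1 := by
        simp only [encodingFunction, toAdd_mul, toAdd_inv, toAdd_ofAdd]
        rw [if_neg (by omega), if_neg (by omega)]
      rw [h2, commutatorElement_one_left]
    · have h1 : encodingFunction h (Multiplicative.ofAdd m) = 1 := by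
        simp only [encodingFunction, toAdd_ofAdd]
        rw [if_neg hm, if_neg hm']
      rw [h1, commutatorElement_one_right]

theorem exists_fg_subgroup_singleSingle_mem (h : ℕ → H) :
    ∃ Γ : Subgroup ((H ≀ᵣ C) ≀ᵣ C), Γ.FG ∧ ∀ i, singleSingle (h i) ∈ Γ := by
  let b : (H ≀ᵣ C) ≀ᵣ C := base (encodingFunction h)
  refine ⟨Subgroup.zpowers b ⊔ inl.range, ?_, fun i => ?_⟩
  · refine Subgroup.FG.sup ⟨{b}, by simp [Subgroup.zpowers_eq_closure]⟩ ?_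
    rw [← Group.fg_iff_subgroup_fg]
    infer_instance
  · rw [singleSingle_eq_commutator, commutatorElement_def]
    have hb : b ∈ Subgroup.zpowers b ⊔ inl.range :=
      le_sup_left (b := inl.range) (Subgroup.mem_zpowers b)
    have hi (q : C) : inl q ∈ Subgroup.zpowers b ⊔ inl.range :=
      le_sup_right (a := Subgroup.zpowers b) ⟨q, rfl⟩
    have hc (q : C) := mul_mem (mul_mem (hi q) hb) (inv_mem (hi q))
    exact mul_mem (mul_mem (mul_mem (hc _) hb) (inv_mem (hc _))) (inv_mem hb)

/-- The quotient ℤ is used up first, so its one step is added on the left and absorbed. -/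
theorem iteratedResidual_wreath_wreath_int_eq_bot {β : Ordinal} (hβ : ω ≤ β)
    (hH : iteratedResidual H β = ⊥) : iteratedResidual ((H ≀ᵣ C) ≀ᵣ C) β = ⊥ := by
  have h1 := iteratedResidual_add_eq_bot iteratedResidual_one_multiplicative_int hH
  rw [one_add_of_omega0_le hβ] at h1
  have h2 := iteratedResidual_add_eq_bot iteratedResidual_one_multiplicative_int h1
  rwa [one_add_of_omega0_le hβ] at h2

theorem exists_fg_hasResidualLength_of_seq {β : Ordinal} (hβ : ω ≤ β) {G : ℕ → Type}
    [∀ n, Group (G n)] [∀ n, Countable (G n)] (hbot : ∀ n, iteratedResidual (G n) β = ⊥)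
    (hinf : ∀ γ < β, ∃ n, Infinite (iteratedResidual (G n) γ)) :
    ∃ (Γ : Type) (_ : Group Γ), Group.FG Γ ∧ HasResidualLength Γ β := by
  have : Nonempty (Σ n, G n) := ⟨⟨0, 1⟩⟩
  obtain ⟨σ, hσ⟩ := exists_surjective_nat (Σ n, G n)
  obtain ⟨Γ, hfg, hΓ⟩ := exists_fg_subgroup_singleSingle_mem
    fun k => (Pi.mulSingle (σ k).1 (σ k).2 : ∀ n, G n)
  refine ⟨Γ, inferInstance, (Group.fg_iff_subgroup_fg _).2 hfg,
    iteratedResidual_eq_bot_of_injective Γ.subtype_injective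
      (iteratedResidual_wreath_wreath_int_eq_bot hβ (iteratedResidual_pi_eq_bot hbot)),
    fun γ hγ => ?_⟩
  obtain ⟨n, hn⟩ := hinf γ hγ
  let f : G n →* Γ := (singleSingle.comp (MonoidHom.mulSingle G n)).codRestrict Γ fun x => by
    obtain ⟨k, hk⟩ := hσ ⟨n, x⟩
    have := hΓ k
    rw [hk] at this
    exact this
  have hf : Function.Injective f := fun x y hxy =>
    Pi.mulSingle_injective n (singleSingle_injective (congrArg Subtype.val hxy))
  exact infinite_iteratedResidual_of_injective hf hn

end Embedding

/-! ### The induction on length and the conclusion. -/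

theorem exists_fg_hasResidualLength (β : Ordinal) (h0 : β ≠ 0) (hβ : β.card ≤ Cardinal.aleph0) :
    ∃ (Γ : Type) (_ : Group Γ), Group.FG Γ ∧ HasResidualLength Γ β := by
  induction β using Ordinal.limitRecOn with
  | zero => exact absurd rfl h0
  | add_one β ih =>
    rcases eq_or_ne β 0 with rfl | hne
    · rw [zero_add]
      exact ⟨Multiplicative ℤ, inferInstance, inferInstance, hasResidualLength_multiplicative_int⟩
    · obtain ⟨Q, _, hQ, hlen⟩ := ih hne ((card_le_card (by simp)).trans hβ)
      exact exists_fg_hasResidualLength_add_one hQ hne hlen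
  | limit β hl ih =>
    have hc : (Set.Iio β).Countable := by
      rw [← Cardinal.le_aleph0_iff_set_countable, Cardinal.mk_Iio_ordinal]
      exact Cardinal.lift_le_aleph0.2 hβ
    obtain ⟨f, hf⟩ := hc.exists_eq_range ⟨0, pos_iff_ne_zero.2 h0⟩
    have hlt (n : ℕ) : f n + 1 < β := hl.add_one_lt (hf ▸ Set.mem_range_self n : f n ∈ Set.Iio β)
    -- Length f n + 1 is nonzero and keeps the residual at f n infinite.
    choose G hG hfg hlen using fun n =>
      ih (f n + 1) (hlt n) (by simp) ((card_le_card (hlt n).le).trans hβ)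
    have (n : ℕ) : Countable (G n) := countable_of_group_fg _ (hfg n)
    refine exists_fg_hasResidualLength_of_seq (omega0_le_of_isSuccLimit hl) (G := G)
      (fun n => ?_) fun γ hγ => ?_
    · have := iteratedResidual_antitone (G := G n) (hlt n).le
      rwa [(hlen n).1, le_bot_iff] at this
    · obtain ⟨n, hn⟩ : γ ∈ Set.range f := hf ▸ hγ
      exact ⟨n, (hlen n).2 γ (by rw [← hn]; simp)⟩

theorem theorem4p1 (α : Ordinal) (hlim : Order.IsSuccLimit α)
    (hcount : α.card ≤ Cardinal.aleph0) :
    ∃ (Γ : Type) (_ : Group Γ), Group.FG Γ ∧ HasResidualFinitenessDepth Γ α := by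
  obtain ⟨β, rfl⟩ := isSuccPrelimit_iff_omega0_dvd.1 hlim.isSuccPrelimit
  have hne : β ≠ 0 := by
    rintro rfl
    simp at hlim
  obtain ⟨Γ, hΓ, hfg, hbot, hinf⟩ := exists_fg_hasResidualLength β hne
    ((card_le_card (le_mul_right β omega0_pos)).trans hcount)
  have := countable_of_group_fg Γ hfg
  exact ⟨Γ, hΓ, hfg, hasResidualFinitenessDepth_omega0_mul hbot hinf⟩
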